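/- Let $k$ be a field and $\mu\ge 0$ an integer. A set $\mathcal H$ of subsets ("faces") of $V=\{1,\dots,\mu\}$ is a separated hypergraph with vertex set $V$ if its faces cover $V$ and for all $j_1<j_2$ in $V$ there are faces $F_1,F_2\in\mathcal H$ with $j_1\in F_1\setminus F_2$ and $j_2\in F_2\setminus F_1$. A square-free monomial ideal $I$ of a polynomial ring $R=k[\mathcal A]$ (on any set $\mathcal A$ of variables) is associated to $\mathcal H$ if $I$ has a minimal monomial generating set $m_1,\dots,m_\mu$ such that a non-empty set $F\subseteq V$ is in $\mathcal H$ if and only if there is a variable $a\in\mathcal A$ with $F=\{j\in V : a\mid m_j\}$ (the empty face, which only records unused variables, is disregarded). For an $R$-module $M$ let $\beta_l(M)=\dim_k\operatorname{Tor}_l^R(M,k)$ be its $l$-th total Betti number, where $k=R/(\mathcal A)$. Let $\mathcal H$ be a separated hypergraph. If $I_1\subseteq R_1=k[\mathcal A_1]$ and $I_2\subseteq R_2=k[\mathcal A_2]$ are square-free monomial ideals associated to $\mathcal H$, then $\beta_l(I_1)=\beta_l(I_2)$ and $\beta_l(R_1/I_1)=\beta_l(R_2/I_2)$ for every $l\ge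 0$, and $\operatorname{pd}_{R_1}(R_1/I_1)=\operatorname{pd}_{R_2}(R_2/I_2)$. Consequently (for fixed $k$) $\operatorname{pd}(\mathcal H)$ is well defined: there is exactly one value $d$ such that $\operatorname{pd}_R(R/I)=d$ for every square-free monomial ideal $I\subseteq R=k[\mathcal A]$ associated to $\mathcal H$. -/

import Mathlib

open CategoryTheory MvPolynomial

universe u v u₁ u₂ w

/-- A set `H` of subsets (faces) of the vertex set `V = {1, …, μ}`, here `Fin μ`, is a hypergraph
with vertex set `V` if its faces cover `V`. -/
def IsHypergraph {μ : ℕ} (H : Set (Finset (Fin μ))) : Prop :=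
  ∀ j : Fin μ, ∃ F ∈ H, j ∈ F

/-- A hypergraph is separated if for any two distinct vertices there are a face that contains the
first but not the second and a face that contains the second but not the first. -/
def IsSeparatedHypergraph {μ : ℕ} (H : Set (Finset (Fin μ))) : Prop :=
  IsHypergraph H ∧
    ∀ j₁ j₂ : Fin μ, j₁ < j₂ →
      ∃ F₁ ∈ H, ∃ F₂ ∈ H, (j₁ ∈ F₁ ∧ j₁ ∉ F₂) ∧ (j₂ ∈ F₂ ∧ j₂ ∉ F₁)

/-- An ideal of `k[σ]` is a square-free monomial ideal if it is generated by a set of square-free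
monomials, i.e. of products of distinct variables. -/
def IsSquarefreeMonomialIdeal {k : Type v} [Field k] {σ : Type u}
    (I : Ideal (MvPolynomial σ k)) : Prop :=
  ∃ S : Set (MvPolynomial σ k), (∀ p ∈ S, ∃ s : Finset σ, p = ∏ a ∈ s, X a) ∧ I = Ideal.span S

/-- `m₁, …, m_μ` is a minimal monomial generating set of `I`: the `m_j` are monomials, they
generate `I`, and no `m_j` can be left out (in particular they are distinct). -/
def IsMinimalMonomialGenerators {k : Type v} [Field k] {σ : Type u} {μ : ℕ}
    (m : Fin μ → MvPolynomial σ k) (I : Ideal (MvPolynomial σ k)) : Prop :=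
  (∀ j, ∃ e : σ →₀ ℕ, m j = monomial e 1) ∧
    Ideal.span (Set.range m) = I ∧
    ∀ j, Ideal.span (m '' {i | i ≠ j}) ≠ I

/-- The hypergraph of `m₁, …, m_μ`: `F` is a face if and only if there is a variable `a` such
that, for every vertex `j`, `a` divides `m_j` if and only if `j ∈ F`. -/
def hypergraphOf {k : Type v} [Field k] {σ : Type u} {μ : ℕ}
    (m : Fin μ → MvPolynomial σ k) : Set (Finset (Fin μ)) :=
  {F | ∃ a : σ, ∀ j : Fin μ, (X a : MvPolynomial σ k) ∣ m j ↔ j ∈ F}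

/-- `I` is a square-free monomial ideal associated to the hypergraph `H`: for some numbering
`m₁, …, m_μ` of its minimal monomial generators, the hypergraph of `m₁, …, m_μ` is `H`.
The empty face is disregarded: it only records whether the polynomial ring has a variable that
divides none of the generators. -/
def IsAssociatedTo {k : Type v} [Field k] {σ : Type u} {μ : ℕ}
    (I : Ideal (MvPolynomial σ k)) (H : Set (Finset (Fin μ))) : Prop :=
  IsSquarefreeMonomialIdeal I ∧
    ∃ m : Fin μ → MvPolynomial σ k,
      IsMinimalMonomialGenerators m I ∧ hypergraphOf m \ {∅} = H \ {∅}

/-- The residue field `k = k[σ] / (all variables)` as a module over `k[σ]`. -/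
noncomputable def residueModule (k : Type v) [Field k] (σ : Type u) :
    ModuleCat.{max u v} (MvPolynomial σ k) :=
  ModuleCat.of (MvPolynomial σ k)
    (MvPolynomial σ k ⧸ (Ideal.span (Set.range X) : Ideal (MvPolynomial σ k)))

/-- The `l`-th total Betti number `dim_k Tor_l^R(M, k)` of a module `M` over `R = k[σ]`, as an
element of `ℕ ∪ {∞}`. Mathlib's `Tor'` is the `Tor` obtained by deriving the first factor; the
`k`-vector space structure is the restriction of the `R`-module structure to `k ⊆ R`. -/
noncomputable def totalBetti {k : Type v} [Field k] {σ : Type u} (l : ℕ)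
    (M : ModuleCat.{max u v} (MvPolynomial σ k)) : ℕ∞ :=
  Cardinal.toENat (Module.rank k
    ((ModuleCat.restrictScalars (algebraMap k (MvPolynomial σ k))).obj
      (((Tor' (ModuleCat.{max u v} (MvPolynomial σ k)) l).obj M).obj (residueModule k σ))))

/-- The `R`-module `R / I`. -/
noncomputable def quotientModule {k : Type v} [Field k] {σ : Type u}
    (I : Ideal (MvPolynomial σ k)) : ModuleCat.{max u v} (MvPolynomial σ k) :=
  ModuleCat.of (MvPolynomial σ k) (MvPolynomial σ k ⧸ I)

/-- The ideal `I`, as an `R`-module. -/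
noncomputable def idealModule {k : Type v} [Field k] {σ : Type u}
    (I : Ideal (MvPolynomial σ k)) : ModuleCat.{max u v} (MvPolynomial σ k) :=
  ModuleCat.of (MvPolynomial σ k) I

/-! Variables with the same face occur only together, through their product. Let `S` be the
polynomial ring with one variable per non-empty face of `H`, and `J` (`faceIdeal`) its ideal
generated, for each vertex, by the product of the faces containing it. If `I ⊆ R` is associated to
`H`, send each face to the product of the variables having it (`fiberHom`); then `I = J R`
(`exists_eq_map_faceIdeal`). `R` is free over `S` with `1` in a basis (`exists_basis_fiberHom`), so
base change is exact and keeps projectives. The residue field of `R` restricts to that of `S`, hence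
Tor over `R` of a base change is Tor over `S` (`lift_rank_tor_baseChange`). The retraction `R → S`
makes projective dimension descend. All invariants of `I` thus equal those of `J`, which depends
only on `H` and `k`. -/

open scoped TensorProduct

/-! ### Freeness of `R` over the ring of faces. -/

section FiberHomFree

/-- Pull back exponents along the partial map `q`. -/
noncomputable def expPullback {σ : Type u} {τ : Type v} (q : σ → Option τ)
    (hfin : ∀ t, (q ⁻¹' {some t}).Finite) : (τ →₀ ℕ) →+ (σ →₀ ℕ) where
  toFun f := Finsupp.ofSupportFinite (fun a => (q a).elim 0 f) (by
    refine ((f.support.finite_toSet).biUnion fun t _ => hfin t).subset fun a ha => ?_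
    rcases h : q a with _ | t
    · simp [h] at ha
    · simp only [Function.mem_support, h, Option.elim_some] at ha
      simp only [Set.mem_iUnion]
      exact ⟨t, by simpa using ha, h⟩)
  map_zero' := by
    ext a
    rcases h : q a with _ | t <;> simp [Finsupp.ofSupportFinite, h]
  map_add' f g := by
    ext a
    change (q a).elim 0 (f + g) = (q a).elim 0 f + (q a).elim 0 g
    rcases q a with _ | t <;> rfl

variable {σ : Type u} {τ : Type v} (q : σ → Option τ) (hfin : ∀ t, (q ⁻¹' {some t}).Finite)

theorem expPullback_apply (f : τ →₀ ℕ) (a : σ) :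
    expPullback q hfin f a = (q a).elim 0 f := rfl

variable {q}

theorem expPullback_eq_zero_iff (hq : ∀ t, ∃ a, q a = some t) (f : τ →₀ ℕ) :
    expPullback q hfin f = 0 ↔ f = 0 := by
  refine ⟨fun h => ?_, by rintro rfl; simp⟩
  ext t
  obtain ⟨a, ha⟩ := hq t
  simpa [expPullback_apply, ha] using DFunLike.congr_fun h a

variable (q) in
/-- The largest exponent whose pullback along `q` is at most `e`. -/
noncomputable def expFloor [Finite τ] (e : σ →₀ ℕ) : τ →₀ ℕ :=
  Finsupp.equivFunOnFinite.symm fun t => sInf (e '' (q ⁻¹' {some t}))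

theorem expPullback_expFloor_le [Finite τ] (e : σ →₀ ℕ) :
    expPullback q hfin (expFloor q e) ≤ e := by
  intro a
  rw [expPullback_apply]
  rcases h : q a with _ | t
  · simp
  · exact Nat.sInf_le ⟨a, h, rfl⟩

/-- A pullback is constant on each fiber, so adding it shifts the fiberwise minimum. Non-empty
fibers keep `sInf` away from its default value on `∅`. -/
theorem expFloor_pullback_add [Finite τ] (hq : ∀ t, ∃ a, q a = some t) (f : τ →₀ ℕ)
    (e : σ →₀ ℕ) : expFloor q (expPullback q hfin f + e) = f + expFloor q e := by
  ext t
  obtain ⟨a, ha⟩ := hq t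
  have hne : (e '' (q ⁻¹' {some t})).Nonempty := ⟨_, a, ha, rfl⟩
  have hne' : ((expPullback q hfin f + e) '' (q ⁻¹' {some t})).Nonempty := ⟨_, a, ha, rfl⟩
  change sInf ((expPullback q hfin f + e) '' (q ⁻¹' {some t})) = f t + sInf (e '' (q ⁻¹' {some t}))
  apply le_antisymm
  · obtain ⟨b, hb, hb'⟩ := Nat.sInf_mem hne
    rw [← hb']
    refine Nat.sInf_le ⟨b, hb, ?_⟩
    have hb : q b = some t := hb
    simp [expPullback_apply, hb]
  · obtain ⟨b, hb, hb'⟩ := Nat.sInf_mem hne'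
    rw [← hb']
    have h2 : sInf (e '' (q ⁻¹' {some t})) ≤ e b := Nat.sInf_le ⟨b, hb, rfl⟩
    have hb : q b = some t := hb
    simpa [expPullback_apply, hb] using h2

theorem expFloor_sub [Finite τ] (hq : ∀ t, ∃ a, q a = some t) (e : σ →₀ ℕ) :
    expFloor q (e - expPullback q hfin (expFloor q e)) = 0 := by
  have h := expFloor_pullback_add hfin hq (expFloor q e) (e - expPullback q hfin (expFloor q e))
  rw [add_tsub_cancel_of_le (expPullback_expFloor_le hfin e)] at h
  simpa using h

variable (q)

/-- The ring homomorphism that sends the variable `t` to the product of the variables in the fiber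
of `q` over `t`. -/
noncomputable def fiberHom (k : Type w) [Field k] :
    MvPolynomial τ k →ₐ[k] MvPolynomial σ k :=
  AddMonoidAlgebra.mapDomainAlgHom k k (expPullback q hfin)

variable (k : Type w) [Field k]

theorem fiberHom_monomial (f : τ →₀ ℕ) (c : k) :
    fiberHom q hfin k (monomial f c) = monomial (expPullback q hfin f) c :=
  AddMonoidAlgebra.mapDomain_single

theorem constantCoeff_fiberHom (hq : ∀ t, ∃ a, q a = some t) (p : MvPolynomial τ k) :
    constantCoeff (fiberHom q hfin k p) = constantCoeff p := by
  induction p using MvPolynomial.induction_on' with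
  | monomial f c =>
    classical
    rw [fiberHom_monomial, constantCoeff_monomial, constantCoeff_monomial]
    simp only [expPullback_eq_zero_iff hfin hq]
  | add p p' hp hp' => simp [hp, hp']

-- Each exponent is uniquely a pullback plus an exponent with minimum zero on every fiber, so this
-- coefficient sees only `b' = b`. It yields linear independence of the basis below.
open scoped Classical in
theorem coeff_fiberHom_mul_monomial [Finite τ] (hq : ∀ t, ∃ a, q a = some t) (p : MvPolynomial τ k)
    (b b' : {e : σ →₀ ℕ // expFloor q e = 0}) (f : τ →₀ ℕ) :
    coeff (expPullback q hfin f + (b : σ →₀ ℕ)) (fiberHom q hfin k p * monomial (b' : σ →₀ ℕ) 1) =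
      if b' = b then coeff f p else 0 := by
  induction p using MvPolynomial.induction_on' with
  | monomial f' c =>
    rw [fiberHom_monomial, monomial_mul, coeff_monomial, coeff_monomial, mul_one]
    by_cases h : expPullback q hfin f' + b' = expPullback q hfin f + b
    · have h1 := congrArg (expFloor q) h
      rw [expFloor_pullback_add hfin hq, expFloor_pullback_add hfin hq, b.2, b'.2, add_zero,
        add_zero] at h1
      subst h1
      have h2 : b' = b := Subtype.ext (add_left_cancel h)
      simp [h2]
    · rw [if_neg h]
      split_ifs with h1 h2
      · subst h1 h2; exact absurd rfl h
      · rfl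
      · rfl
  | add p p' hp hp' =>
    rw [map_add, add_mul, coeff_add, hp, hp']
    split_ifs <;> simp

theorem expFloor_zero [Finite τ] (hq : ∀ t, ∃ a, q a = some t) : expFloor q 0 = 0 := by
  ext t
  obtain ⟨a, ha⟩ := hq t
  exact Nat.eq_zero_of_le_zero (Nat.sInf_le ⟨a, ha, rfl⟩)

/-- The basis consists of the monomials not divisible by the full product of any fiber. That `1`
belongs to it provides the retraction used for descent. -/
theorem exists_basis_fiberHom [Finite τ] (hq : ∀ t, ∃ a, q a = some t) :
    let := (fiberHom q hfin k).toAlgebra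
    ∃ (b : Module.Basis {e : σ →₀ ℕ // expFloor q e = 0} (MvPolynomial τ k) (MvPolynomial σ k))
      (i : {e : σ →₀ ℕ // expFloor q e = 0}), b i = 1 := by
  classical
  let := (fiberHom q hfin k).toAlgebra
  have hsmul (p : MvPolynomial τ k) (r : MvPolynomial σ k) : p • r = fiberHom q hfin k p * r := rfl
  let v : {e : σ →₀ ℕ // expFloor q e = 0} → MvPolynomial σ k := fun b => monomial (b : σ →₀ ℕ) 1
  refine ⟨Module.Basis.mk (v := v) ?_ ?_, ⟨0, expFloor_zero q hq⟩, ?_⟩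
  · rw [linearIndependent_iff']
    intro s g hg b hb
    ext f
    have h := congrArg (coeff (expPullback q hfin f + (b : σ →₀ ℕ))) hg
    simp only [hsmul, coeff_sum, v, coeff_fiberHom_mul_monomial q hfin k hq] at h
    simpa [hb] using h
  · rintro p -
    induction p using MvPolynomial.induction_on' with
    | monomial e c =>
      have : monomial e c = monomial (expFloor q e) c •
          v ⟨e - expPullback q hfin (expFloor q e), expFloor_sub hfin hq e⟩ := by
        rw [hsmul, fiberHom_monomial, monomial_mul, mul_one,
          add_tsub_cancel_of_le (expPullback_expFloor_le hfin e)]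
      rw [this]
      exact Submodule.smul_mem _ _ (Submodule.subset_span ⟨_, rfl⟩)
    | add p p' hp hp' => exact Submodule.add_mem _ hp hp'
  · rw [Module.Basis.mk_apply]
    rfl

end FiberHomFree

/-! ### Projective dimension under free base change. -/

section BaseChange

variable (S : Type v) (R : Type u) [CommRing S] [CommRing R] [Algebra S R]

/-- Base change of modules along `S → R`. -/
noncomputable def baseChangeFunctor : ModuleCat.{v} S ⥤ ModuleCat.{max u v} R where
  obj M := ModuleCat.of R (R ⊗[S] M)
  map f := ModuleCat.ofHom (f.hom.baseChange R)
  map_id M := by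
    ext : 1
    exact LinearMap.baseChange_id
  map_comp f g := by
    ext : 1
    exact LinearMap.baseChange_comp _ _

instance : (baseChangeFunctor S R).Additive where
  map_add {M N f g} := by
    ext : 1
    exact LinearMap.baseChange_add _ _

instance [Module.Flat S R] : (baseChangeFunctor S R).PreservesHomology := by
  apply Functor.preservesHomology_of_map_exact
  intro T hT
  rw [ShortComplex.ShortExact.moduleCat_exact_iff_function_exact] at hT ⊢
  exact Module.Flat.lTensor_exact R hT

instance [Module.Flat S R] : Limits.PreservesFiniteLimits (baseChangeFunctor S R) :=
  (baseChangeFunctor S R).preservesFiniteLimits_of_preservesHomology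

instance [Module.Flat S R] : Limits.PreservesFiniteColimits (baseChangeFunctor S R) :=
  (baseChangeFunctor S R).preservesFiniteColimits_of_preservesHomology

instance : (baseChangeFunctor S R).PreservesProjectiveObjects where
  projective_obj {M} hM := by
    rw [← IsProjective.iff_projective] at hM ⊢
    exact inferInstanceAs (Module.Projective R (R ⊗[S] M))

variable {S R}

/-- A retraction of `S → R` as `S`-modules makes every `S`-module a retract of its base change. -/
theorem exists_retraction_baseChange (ρ : R →ₗ[S] S) (hρ : ρ 1 = 1) (M : Type*) [AddCommGroup M]
    [Module S M] : ∃ r : R ⊗[S] M →ₗ[S] M, r ∘ₗ (TensorProduct.mk S R M 1) = LinearMap.id :=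
  ⟨TensorProduct.lid S M ∘ₗ ρ.rTensor M, by ext m; simp [hρ]⟩

theorem projective_of_baseChange [Module.Free S R] (ρ : R →ₗ[S] S) (hρ : ρ 1 = 1)
    (M : Type*) [AddCommGroup M] [Module S M] [Module.Projective R (R ⊗[S] M)] :
    Module.Projective S M := by
  -- A summand of a free `R`-module is a summand of a free `S`-module, as `R` is `S`-free.
  have : Module.Projective S (R ⊗[S] M) := by
    obtain ⟨s, hs⟩ := (Module.projective_def' (R := R) (P := R ⊗[S] M)).1 inferInstance
    exact Module.Projective.of_split (s.restrictScalars S)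
      ((Finsupp.linearCombination R id).restrictScalars S)
      (LinearMap.ext fun x => LinearMap.congr_fun hs x)
  obtain ⟨r, hr⟩ := exists_retraction_baseChange ρ hρ M
  exact Module.Projective.of_split _ r hr

theorem isZero_of_baseChange (ρ : R →ₗ[S] S) (hρ : ρ 1 = 1) (M : ModuleCat.{v} S)
    (h : Limits.IsZero ((baseChangeFunctor S R).obj M)) : Limits.IsZero M := by
  rw [ModuleCat.isZero_iff_subsingleton] at h ⊢
  have h : Subsingleton (R ⊗[S] M) := h
  obtain ⟨r, hr⟩ := exists_retraction_baseChange ρ hρ M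
  exact (Function.LeftInverse.injective (g := r) fun m => LinearMap.congr_fun hr m).subsingleton

/-- Dimension shifting along a projective cover's kernel reduces to the zero and projective cases,
which descend by the retraction. -/
theorem hasProjectiveDimensionLT_baseChange_iff [Module.Free S R] (ρ : R →ₗ[S] S)
    (hρ : ρ 1 = 1) (n : ℕ) (M : ModuleCat.{v} S) :
    HasProjectiveDimensionLT ((baseChangeFunctor S R).obj M) n ↔ HasProjectiveDimensionLT M n := by
  induction n generalizing M with
  | zero =>
    rw [hasProjectiveDimensionLT_zero_iff_isZero, hasProjectiveDimensionLT_zero_iff_isZero]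
    exact ⟨isZero_of_baseChange ρ hρ M, (baseChangeFunctor S R).map_isZero⟩
  | succ n ih =>
    rcases n with _ | n
    · rw [zero_add, ← projective_iff_hasProjectiveDimensionLT_one,
        ← projective_iff_hasProjectiveDimensionLT_one]
      refine ⟨fun h => ?_, fun h => (baseChangeFunctor S R).projective_obj _⟩
      rw [← IsProjective.iff_projective] at h ⊢
      have : Module.Projective R (R ⊗[S] M) := h
      exact projective_of_baseChange ρ hρ M
    · obtain ⟨⟨P, f⟩⟩ := (ModuleCat.enoughProjectives (R := S)).1 M
      let T := ShortComplex.mk (Limits.kernel.ι f) f (Limits.kernel.condition f)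
      have hT : T.ShortExact := { exact := ShortComplex.exact_kernel f }
      have hT' : (T.map (baseChangeFunctor S R)).ShortExact :=
        hT.map_of_exact (baseChangeFunctor S R)
      have : Projective (T.map (baseChangeFunctor S R)).X₂ :=
        (baseChangeFunctor S R).projective_obj P
      exact ((hT'.hasProjectiveDimensionLT_X₃_iff n ‹_›).trans (ih _)).trans
        (hT.hasProjectiveDimensionLT_X₃_iff n ‹_›).symm

theorem projectiveDimension_baseChange [Module.Free S R] (ρ : R →ₗ[S] S)
    (hρ : ρ 1 = 1) (M : ModuleCat.{v} S) :
    projectiveDimension ((baseChangeFunctor S R).obj M) = projectiveDimension M := by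
  simp only [projectiveDimension, hasProjectiveDimensionLT_baseChange_iff ρ hρ]

end BaseChange

/-! ### Tor under flat base change. -/

section Homology

/-- Linearly isomorphic short complexes of modules, possibly in different universes, have linearly
isomorphic homology. -/
theorem nonempty_homology_linearEquiv {k : Type w} [CommRing k] (A : ShortComplex (ModuleCat.{u₁} k))
    (B : ShortComplex (ModuleCat.{u₂} k)) (e₁ : A.X₁ ≃ₗ[k] B.X₁) (e₂ : A.X₂ ≃ₗ[k] B.X₂)
    (e₃ : A.X₃ ≃ₗ[k] B.X₃) (h₁₂ : ∀ x, e₂ (A.f.hom x) = B.f.hom (e₁ x))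
    (h₂₃ : ∀ x, e₃ (A.g.hom x) = B.g.hom (e₂ x)) :
    Nonempty (A.homology ≃ₗ[k] B.homology) := by
  have hker : (LinearMap.ker A.g.hom).map (e₂ : A.X₂ →ₗ[k] B.X₂) = LinearMap.ker B.g.hom := by
    ext y
    simp only [Submodule.mem_map, LinearMap.mem_ker]
    constructor
    · rintro ⟨x, hx, rfl⟩
      exact (h₂₃ x).symm.trans (by simp [hx])
    · intro hy
      refine ⟨e₂.symm y, e₃.injective ?_, by simp⟩
      simp [h₂₃, hy]
  let e : LinearMap.ker A.g.hom ≃ₗ[k] LinearMap.ker B.g.hom := e₂.ofSubmodules _ _ hker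
  have hrange : (LinearMap.range A.moduleCatToCycles).map
      (e : LinearMap.ker A.g.hom →ₗ[k] LinearMap.ker B.g.hom) =
        LinearMap.range B.moduleCatToCycles := by
    ext y
    simp only [Submodule.mem_map, LinearMap.mem_range]
    constructor
    · rintro ⟨_, ⟨x, rfl⟩, rfl⟩
      exact ⟨e₁ x, Subtype.ext (h₁₂ x).symm⟩
    · rintro ⟨x, rfl⟩
      refine ⟨_, ⟨e₁.symm x, rfl⟩, Subtype.ext ?_⟩
      exact (h₁₂ _).trans (by simp; rfl)
  exact ⟨A.moduleCatHomologyIso.toLinearEquiv.trans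
    ((Submodule.Quotient.equiv _ _ e hrange).trans B.moduleCatHomologyIso.toLinearEquiv.symm)⟩

end Homology

section TorBaseChange

variable {S R : Type*} [CommRing S] [CommRing R] [Algebra S R]
  {κ κ' : Type*} [AddCommGroup κ] [Module S κ] [AddCommGroup κ'] [Module S κ'] [Module R κ']
  [IsScalarTower S R κ']

/-- Tensoring the base change of `M` with `κ'` is tensoring `M` with the restriction of `κ'`. -/
noncomputable def baseChangeTensorEquiv (ε : κ' ≃ₗ[S] κ) (M : Type*) [AddCommGroup M] [Module S M] :
    (R ⊗[S] M) ⊗[R] κ' ≃ₗ[S] M ⊗[S] κ :=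
  ((TensorProduct.comm R (R ⊗[S] M) κ').restrictScalars S).trans
    (((TensorProduct.AlgebraTensorModule.cancelBaseChange S R R κ' M).restrictScalars S).trans
      ((TensorProduct.comm S κ' M).trans (TensorProduct.congr (LinearEquiv.refl S M) ε)))

theorem baseChangeTensorEquiv_tmul (ε : κ' ≃ₗ[S] κ) (M : Type*) [AddCommGroup M] [Module S M]
    (r : R) (m : M) (x : κ') :
    baseChangeTensorEquiv ε M ((r ⊗ₜ[S] m) ⊗ₜ[R] x) = m ⊗ₜ ε (r • x) := by
  simp [baseChangeTensorEquiv]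

theorem baseChangeTensorEquiv_naturality (ε : κ' ≃ₗ[S] κ) {M N : Type*} [AddCommGroup M]
    [Module S M] [AddCommGroup N] [Module S N] (f : M →ₗ[S] N) (x : (R ⊗[S] M) ⊗[R] κ') :
    baseChangeTensorEquiv ε N ((f.baseChange R).rTensor κ' x) =
      f.rTensor κ (baseChangeTensorEquiv ε M x) := by
  induction x with
  | zero => simp
  | add x y hx hy => simp only [map_add, hx, hy]
  | tmul y z =>
    induction y with
    | zero => simp
    | add y y' hy hy' => simp only [TensorProduct.add_tmul, map_add, hy, hy']
    | tmul r m =>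
      rw [LinearMap.rTensor_tmul, LinearMap.baseChange_tmul, baseChangeTensorEquiv_tmul,
        baseChangeTensorEquiv_tmul, LinearMap.rTensor_tmul]

end TorBaseChange

section TorRank

variable {k : Type w} [Field k] {S : Type v} {R : Type (max u v)} [CommRing S] [CommRing R]
  [Algebra S R] [Algebra k S] [Algebra k R] [IsScalarTower k S R]

/-- The equivalence `baseChangeTensorEquiv` over a common base field. -/
noncomputable def tensorResidueEquiv (κ : ModuleCat.{v} S) (κ' : ModuleCat.{max u v} R)
    [Module S κ'] [IsScalarTower S R κ'] (ε : κ' ≃ₗ[S] κ) (M : ModuleCat.{v} S) :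
    (ModuleCat.restrictScalars (algebraMap k R)).obj
        (((MonoidalCategory.tensoringRight _).obj κ').obj ((baseChangeFunctor S R).obj M)) ≃ₗ[k]
      (ModuleCat.restrictScalars (algebraMap k S)).obj
        (((MonoidalCategory.tensoringRight _).obj κ).obj M) :=
  { (baseChangeTensorEquiv ε M).toAddEquiv with
    map_smul' := fun c x => by
      change baseChangeTensorEquiv ε M ((algebraMap k R c) • (show (R ⊗[S] M) ⊗[R] κ' from x)) =
        (algebraMap k S c) • baseChangeTensorEquiv ε M x
      rw [IsScalarTower.algebraMap_apply k S R, algebraMap_smul, map_smul] }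

theorem lift_rank_tor_baseChange [Module.Flat S R] (κ : ModuleCat.{v} S)
    (κ' : ModuleCat.{max u v} R) [Module S κ'] [IsScalarTower S R κ'] (ε : κ' ≃ₗ[S] κ) (l : ℕ)
    (M : ModuleCat.{v} S) :
    Cardinal.lift.{v} (Module.rank k ((ModuleCat.restrictScalars (algebraMap k R)).obj
        (((Tor' (ModuleCat.{max u v} R) l).obj ((baseChangeFunctor S R).obj M)).obj κ'))) =
      Cardinal.lift.{max u v} (Module.rank k ((ModuleCat.restrictScalars (algebraMap k S)).obj
        (((Tor' (ModuleCat.{v} S) l).obj M).obj κ))) := by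
  obtain ⟨P⟩ := (inferInstance : HasProjectiveResolution M).out
  let F := (MonoidalCategory.tensoringRight (ModuleCat.{v} S)).obj κ
  let F' := (MonoidalCategory.tensoringRight (ModuleCat.{max u v} R)).obj κ'
  let A := (F.mapHomologicalComplex _).obj P.complex
  let A' := (F'.mapHomologicalComplex _).obj
    (((baseChangeFunctor S R).mapProjectiveResolution P).complex)
  let i : ((Tor' (ModuleCat.{v} S) l).obj M).obj κ ≅ (A.sc l).homology := P.isoLeftDerivedObj F l
  let i' : ((Tor' (ModuleCat.{max u v} R) l).obj ((baseChangeFunctor S R).obj M)).obj κ' ≅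
      (A'.sc l).homology :=
    ((baseChangeFunctor S R).mapProjectiveResolution P).isoLeftDerivedObj F' l
  -- Restriction to `k` is exact, so it commutes with homology and both complexes can be compared
  -- over `k`.
  let ρ := ModuleCat.restrictScalars.{v} (algebraMap k S)
  let ρ' := ModuleCat.restrictScalars.{max u v} (algebraMap k R)
  let j := (ρ.mapIso i ≪≫ ((A.sc l).mapHomologyIso ρ).symm).toLinearEquiv
  let j' := (ρ'.mapIso i' ≪≫ ((A'.sc l).mapHomologyIso ρ').symm).toLinearEquiv
  obtain ⟨e⟩ := nonempty_homology_linearEquiv ((A'.sc l).map ρ') ((A.sc l).map ρ)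
    (tensorResidueEquiv κ κ' ε _) (tensorResidueEquiv κ κ' ε _) (tensorResidueEquiv κ κ' ε _)
    (fun x => baseChangeTensorEquiv_naturality ε (P.complex.d _ _).hom x)
    (fun x => baseChangeTensorEquiv_naturality ε (P.complex.d _ _).hom x)
  exact ((j'.trans e).trans j.symm).lift_rank_eq

end TorRank

theorem mem_span_range_X_iff {k : Type w} [Field k] {σ : Type u} (p : MvPolynomial σ k) :
    p ∈ Ideal.span (Set.range (X : σ → MvPolynomial σ k)) ↔ constantCoeff p = 0 := by
  have h := mem_pow_idealOfVars_iff' 1 p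
  rw [pow_one] at h
  simp only [Nat.lt_one_iff, Finsupp.degree_eq_zero_iff, forall_eq] at h
  exact h

/-- If `R` is flat over `S`, the base change of an ideal of `S` is its extension to `R`. -/
noncomputable def baseChangeIdealEquiv {S : Type v} (R : Type u) [CommRing S] [CommRing R]
    [Algebra S R] [Module.Flat S R] (J : Ideal S) :
    (R ⊗[S] J) ≃ₗ[R] (J.map (algebraMap S R)) :=
  (LinearEquiv.ofInjective
    ((TensorProduct.AlgebraTensorModule.rid S R R).toLinearMap ∘ₗ J.subtype.baseChange R)
    ((TensorProduct.AlgebraTensorModule.rid S R R).injective.comp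
      (Module.Flat.lTensor_preserves_injective_linearMap _ J.subtype_injective))).trans
  (LinearEquiv.ofEq _ _ (by
    apply le_antisymm
    · rintro _ ⟨x, rfl⟩
      induction x with
      | zero => simp
      | add x y hx hy => rw [map_add]; exact Ideal.add_mem _ hx hy
      | tmul r j =>
        have : ((TensorProduct.AlgebraTensorModule.rid S R R).toLinearMap ∘ₗ
            J.subtype.baseChange R) (r ⊗ₜ j) = r * algebraMap S R j := by
          simp [Algebra.smul_def, mul_comm]
        rw [this]
        exact Ideal.mul_mem_left _ _ (Ideal.mem_map_of_mem _ j.2)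
    · refine Ideal.span_le.2 ?_
      rintro _ ⟨j, hj, rfl⟩
      exact ⟨1 ⊗ₜ ⟨j, hj⟩, by simp [Algebra.smul_def]⟩))

/-! ### Residue fields and transfer of the invariants. -/

section FiberHom

variable {k : Type w} [Field k] {σ : Type u} {τ : Type v} (q : σ → Option τ)
  (hfin : ∀ t, (q ⁻¹' {some t}).Finite)

/-- Non-empty fibers make `fiberHom` preserve constant terms, so both quotients are `k` with the
same `S`-action. -/
theorem exists_residue_equiv (hq : ∀ t, ∃ a, q a = some t) :
    let := (fiberHom q hfin k).toAlgebra
    Nonempty ((MvPolynomial σ k ⧸ (Ideal.span (Set.range X) : Ideal (MvPolynomial σ k)))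
      ≃ₗ[MvPolynomial τ k]
        (MvPolynomial τ k ⧸ (Ideal.span (Set.range X) : Ideal (MvPolynomial τ k)))) := by
  let := (fiberHom q hfin k).toAlgebra
  let L := Algebra.linearMap (MvPolynomial τ k)
    (MvPolynomial σ k ⧸ (Ideal.span (Set.range X) : Ideal (MvPolynomial σ k)))
  have hL (p) : L p = Ideal.Quotient.mk _ (fiberHom q hfin k p) := rfl
  have hker : LinearMap.ker L = Ideal.span (Set.range X) := by
    ext p
    rw [LinearMap.mem_ker, hL, Ideal.Quotient.eq_zero_iff_mem, mem_span_range_X_iff,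
      constantCoeff_fiberHom q hfin k hq]
    exact (mem_span_range_X_iff p).symm
  have hsurj : Function.Surjective L := by
    intro x
    obtain ⟨p, rfl⟩ := Ideal.Quotient.mk_surjective x
    refine ⟨C (constantCoeff p), ?_⟩
    rw [hL, Ideal.Quotient.eq, mem_span_range_X_iff, map_sub, constantCoeff_fiberHom q hfin k hq]
    simp
  exact ⟨(L.quotKerEquivOfSurjective hsurj).symm.trans (Submodule.quotEquivOfEq _ _ hker)⟩

end FiberHom

section Invariants

variable {k : Type w} [Field k] {σ : Type u} {τ : Type} [Finite τ] (q : σ → Option τ)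
  (hfin : ∀ t, (q ⁻¹' {some t}).Finite)

theorem totalBetti_baseChange (hq : ∀ t, ∃ a, q a = some t) (l : ℕ)
    (M : ModuleCat.{w} (MvPolynomial τ k)) (N : ModuleCat.{max u w} (MvPolynomial σ k)) :
    let := (fiberHom q hfin k).toAlgebra
    Nonempty ((MvPolynomial σ k ⊗[MvPolynomial τ k] M) ≃ₗ[MvPolynomial σ k] N) →
    totalBetti l N = totalBetti l M := by
  rintro _ ⟨i⟩
  have : IsScalarTower k (MvPolynomial τ k) (MvPolynomial σ k) :=
    IsScalarTower.of_algebraMap_eq fun c => ((fiberHom q hfin k).commutes c).symm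
  obtain ⟨b, -, -⟩ := exists_basis_fiberHom q hfin k hq
  have : Module.Free (MvPolynomial τ k) (MvPolynomial σ k) := Module.Free.of_basis b
  let κ' := MvPolynomial σ k ⧸ (Ideal.span (Set.range X) : Ideal (MvPolynomial σ k))
  let : Module (MvPolynomial τ k) (residueModule k σ) :=
    (inferInstance : Module (MvPolynomial τ k) κ')
  have : IsScalarTower (MvPolynomial τ k) (MvPolynomial σ k) (residueModule k σ) :=
    (inferInstance : IsScalarTower (MvPolynomial τ k) (MvPolynomial σ k) κ')
  obtain ⟨ε⟩ := exists_residue_equiv (k := k) q hfin hq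
  let e : (baseChangeFunctor (MvPolynomial τ k) (MvPolynomial σ k)).obj M ≅ N := i.toModuleIso
  have h := lift_rank_tor_baseChange (k := k) (residueModule k τ) (residueModule k σ) ε l M
  have h' := ((ModuleCat.restrictScalars (algebraMap k (MvPolynomial σ k))).mapIso
    (((Tor' (ModuleCat.{max u w} (MvPolynomial σ k)) l).mapIso e).app
      (residueModule k σ))).toLinearEquiv.rank_eq
  have h'' := congrArg Cardinal.toENat h
  rw [Cardinal.toENat_lift, Cardinal.toENat_lift] at h''
  exact (congrArg Cardinal.toENat h').symm.trans h''

theorem invariants_map_fiberHom (hq : ∀ t, ∃ a, q a = some t) (J : Ideal (MvPolynomial τ k)) :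
    (∀ l, totalBetti l (idealModule (J.map (fiberHom q hfin k))) = totalBetti l (idealModule J)) ∧
    (∀ l, totalBetti l (quotientModule (J.map (fiberHom q hfin k))) =
      totalBetti l (quotientModule J)) ∧
    projectiveDimension (quotientModule (J.map (fiberHom q hfin k))) =
      projectiveDimension (quotientModule J) := by
  let := (fiberHom q hfin k).toAlgebra
  obtain ⟨b, i, hi⟩ := exists_basis_fiberHom q hfin k hq
  have : Module.Free (MvPolynomial τ k) (MvPolynomial σ k) := Module.Free.of_basis b
  have eI : (MvPolynomial σ k ⊗[MvPolynomial τ k] J) ≃ₗ[MvPolynomial σ k]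
      (J.map (fiberHom q hfin k)) := baseChangeIdealEquiv (MvPolynomial σ k) J
  have eQ : (MvPolynomial σ k ⊗[MvPolynomial τ k] (MvPolynomial τ k ⧸ J)) ≃ₗ[MvPolynomial σ k]
      (MvPolynomial σ k ⧸ J.map (fiberHom q hfin k)) :=
    (Algebra.TensorProduct.quotIdealMapEquivTensorQuot (MvPolynomial σ k) J).symm.toLinearEquiv
  refine ⟨fun l => totalBetti_baseChange q hfin hq l _ _ ⟨eI⟩,
    fun l => totalBetti_baseChange q hfin hq l _ _ ⟨eQ⟩, ?_⟩
  have e : (baseChangeFunctor (MvPolynomial τ k) (MvPolynomial σ k)).obj (quotientModule J) ≅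
      quotientModule (J.map (fiberHom q hfin k)) := eQ.toModuleIso
  rw [← projectiveDimension_eq_of_iso e]
  exact projectiveDimension_baseChange (b.coord i) (by rw [← hi]; simp) _

end Invariants

/-! ### The canonical ideal of a hypergraph. -/

section Canonical

variable {μ : ℕ} {τ : Type u} [Finite τ] (p : τ → Finset (Fin μ))

/-- The exponent of the product of the variables whose face contains `j`. -/
noncomputable def faceExp (j : Fin μ) : τ →₀ ℕ :=
  Finsupp.equivFunOnFinite.symm fun t => if j ∈ p t then 1 else 0

theorem faceExp_apply (j : Fin μ) (t : τ) : faceExp p j t = if j ∈ p t then 1 else 0 := rfl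

theorem faceExp_ne_zero_iff (j : Fin μ) (t : τ) : faceExp p j t ≠ 0 ↔ j ∈ p t := by
  simp [faceExp_apply]

/-- The square-free monomial ideal of a family of faces. -/
noncomputable def faceIdeal (k : Type w) [Field k] : Ideal (MvPolynomial τ k) :=
  Ideal.span (Set.range fun j => monomial (faceExp p j) 1)

end Canonical

theorem prod_X_eq_monomial {k : Type w} [Field k] {σ : Type u} (s : Finset σ) :
    ∏ a ∈ s, (X a : MvPolynomial σ k) = monomial (∑ a ∈ s, Finsupp.single a 1) 1 :=
  (monomial_sum_one s fun a => Finsupp.single a 1).symm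

theorem sum_single_one_le_one {σ : Type u} (s : Finset σ) (a : σ) :
    (∑ b ∈ s, Finsupp.single b 1 : σ →₀ ℕ) a ≤ 1 := by
  classical
  rw [Finsupp.finsetSum_apply]
  simp only [Finsupp.single_apply, Finset.sum_ite_eq']
  split_ifs <;> simp

theorem X_dvd_monomial_one_iff {k : Type w} [Field k] {σ : Type u} (a : σ) (e : σ →₀ ℕ) :
    (X a : MvPolynomial σ k) ∣ monomial e 1 ↔ e a ≠ 0 := by
  simp [X_dvd_monomial]

/-- A monomial lies in the ideal generated by monomials if and only if one of them divides it. -/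
theorem monomial_mem_span_image_iff {k : Type w} [Field k] {σ : Type u} (E : Set (σ →₀ ℕ))
    (e : σ →₀ ℕ) :
    (monomial e 1 : MvPolynomial σ k) ∈ Ideal.span ((fun s => monomial s (1 : k)) '' E) ↔
      ∃ s ∈ E, s ≤ e := by
  classical
  rw [mem_ideal_span_monomial_image]
  simp [support_monomial]

theorem le_one_of_isMinimalMonomialGenerators {k : Type w} [Field k] {σ : Type u} {μ : ℕ}
    {I : Ideal (MvPolynomial σ k)} (hI : IsSquarefreeMonomialIdeal I) (e : Fin μ → σ →₀ ℕ)
    (hm : IsMinimalMonomialGenerators (fun j => monomial (e j) (1 : k)) I) (j : Fin μ) (a : σ) :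
    e j a ≤ 1 := by
  obtain ⟨S, hS, hIS⟩ := hI
  obtain ⟨-, hspan, hmin⟩ := hm
  let E : Set (σ →₀ ℕ) := {s | monomial s (1 : k) ∈ S ∧ ∀ a, s a ≤ 1}
  have hSE : S = (fun s => monomial s (1 : k)) '' E := by
    ext p
    constructor
    · intro hp
      obtain ⟨s, rfl⟩ := hS p hp
      rw [prod_X_eq_monomial] at hp ⊢
      exact ⟨_, ⟨hp, sum_single_one_le_one s⟩, rfl⟩
    · rintro ⟨s, hs, rfl⟩
      exact hs.1
  have hj : monomial (e j) (1 : k) ∈ I := hspan ▸ Ideal.subset_span ⟨j, rfl⟩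
  rw [hIS, hSE, monomial_mem_span_image_iff] at hj
  obtain ⟨s, hs, hsj⟩ := hj
  have hsI : monomial s (1 : k) ∈ I := hIS ▸ Ideal.subset_span hs.1
  have hrange : Set.range (fun j => monomial (e j) (1 : k)) =
      (fun s => monomial s (1 : k)) '' Set.range e := by
    rw [← Set.range_comp]; rfl
  rw [← hspan, hrange, monomial_mem_span_image_iff] at hsI
  obtain ⟨_, ⟨i, rfl⟩, his⟩ := hsI
  -- `m_i` divides the square-free `s`, which divides `m_j`; minimality forces `i = j`, so `m_j`
  -- divides `s`.
  have hij : i = j := by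
    by_contra hij
    refine hmin j (le_antisymm ?_ ?_)
    · rw [← hspan]
      exact Ideal.span_mono (Set.image_subset_range _ _)
    · rw [← hspan, Ideal.span_le]
      rintro _ ⟨l, rfl⟩
      by_cases hl : l = j
      · subst hl
        refine Ideal.mem_of_dvd _ ?_ (Ideal.subset_span ⟨i, hij, rfl⟩)
        exact monomial_dvd_monomial.2 ⟨Or.inr (his.trans hsj), dvd_rfl⟩
      · exact Ideal.subset_span ⟨l, hl, rfl⟩
  subst hij
  exact (his a).trans (hs.2 a)

theorem exists_eq_map_faceIdeal {k : Type w} [Field k] {μ : ℕ} {H : Set (Finset (Fin μ))}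
    {σ : Type u} {I : Ideal (MvPolynomial σ k)} (hI : IsAssociatedTo I H) :
    ∃ (q : σ → Option {F // F ∈ H \ {∅}}) (hfin : ∀ t, (q ⁻¹' {some t}).Finite),
      (∀ t, ∃ a, q a = some t) ∧ I = (faceIdeal Subtype.val k).map (fiberHom q hfin k) := by
  classical
  obtain ⟨hsq, m, hm, hH⟩ := hI
  choose e he using hm.1
  obtain rfl : m = fun j => monomial (e j) 1 := funext he
  have hle := le_one_of_isMinimalMonomialGenerators hsq e hm
  let face (a : σ) : Finset (Fin μ) := Finset.univ.filter fun j => e j a ≠ 0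
  have hface (a : σ) (j : Fin μ) : j ∈ face a ↔ e j a ≠ 0 := by simp [face]
  have hyper (F) : F ∈ hypergraphOf (fun j => monomial (e j) (1 : k)) ↔ ∃ a, face a = F := by
    refine exists_congr fun a => ?_
    simp only [X_dvd_monomial_one_iff, ← hface, Finset.ext_iff]
  have hmem (a : σ) (ha : face a ≠ ∅) : face a ∈ H \ {∅} := by
    rw [← hH]
    exact ⟨(hyper _).2 ⟨a, rfl⟩, ha⟩
  let q (a : σ) : Option {F // F ∈ H \ {∅}} :=
    if h : face a ≠ ∅ then some ⟨face a, hmem a h⟩ else none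
  have hq (a t) : q a = some t ↔ face a = t.1 := by
    by_cases h : face a ≠ ∅
    · simp only [q, dif_pos h, Option.some_inj]
      exact Subtype.ext_iff
    · simp only [q, dif_neg h, reduceCtorEq, false_iff]
      intro h'
      exact t.2.2 (h' ▸ not_not.1 h)
  -- Even for infinite `σ`: a non-empty face contains some `j`, and only finitely many variables
  -- divide `m_j`.
  have hfin (t) : (q ⁻¹' {some t}).Finite := by
    obtain ⟨j, hj⟩ := Finset.nonempty_iff_ne_empty.2 t.2.2
    refine (e j).support.finite_toSet.subset fun a ha => ?_
    have ha := (hq a t).1 ha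
    rw [← ha, hface] at hj
    simpa using hj
  refine ⟨q, hfin, fun t => ?_, ?_⟩
  · obtain ⟨a, ha⟩ := (hyper t.1).1 (hH.ge t.2).1
    exact ⟨a, (hq a t).2 ha⟩
  · rw [faceIdeal, Ideal.map_span, ← hm.2.1, ← Set.range_comp]
    congr 2
    ext1 j
    rw [Function.comp_apply]
    change _ = fiberHom q hfin k _
    rw [fiberHom_monomial]
    refine congrArg (fun s => monomial s (1 : k)) (Finsupp.ext fun a => ?_)
    rw [expPullback_apply]
    rcases h : q a with _ | t
    · have h0 : face a = ∅ := by
        by_contra h0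
        simp [q, h0] at h
      have := hface a j
      simpa [h0] using this
    · rw [Option.elim_some, faceExp_apply, ← (hq a t).1 h]
      have := hle j a
      by_cases hj : j ∈ face a
      · have := (hface a j).1 hj
        rw [if_pos hj]
        omega
      · rw [if_neg hj]
        exact not_not.1 (mt (hface a j).2 hj)

/-- Separation says exactly that no generator divides another. `ULift` places the variables in the
universe over which the uniqueness claim quantifies. -/
theorem isAssociatedTo_faceIdeal (k : Type w) [Field k] {μ : ℕ} {H : Set (Finset (Fin μ))}
    (hH : IsSeparatedHypergraph H) :
    IsAssociatedTo
      (faceIdeal (fun t : ULift.{u₁} {F // F ∈ H \ {∅}} => t.down.1) k) H := by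
  classical
  have := Fintype.ofFinite {F // F ∈ H \ {∅}}
  set p := fun t : ULift.{u₁} {F // F ∈ H \ {∅}} => t.down.1
  have hsep (i j : Fin μ) (hij : i ≠ j) : ∃ F ∈ H, i ∈ F ∧ j ∉ F := by
    rcases lt_or_gt_of_ne hij with h | h
    · obtain ⟨F₁, hF₁, F₂, hF₂, h₁, h₂⟩ := hH.2 i j h
      exact ⟨F₁, hF₁, h₁.1, h₂.2⟩
    · obtain ⟨F₁, hF₁, F₂, hF₂, h₁, h₂⟩ := hH.2 j i h
      exact ⟨F₂, hF₂, h₂.1, h₁.2⟩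
  refine ⟨⟨_, ?_, rfl⟩, fun j => monomial (faceExp p j) 1, ⟨fun j => ⟨_, rfl⟩, rfl, fun j h => ?_⟩,
    ?_⟩
  · rintro _ ⟨j, rfl⟩
    refine ⟨Finset.univ.filter fun t => j ∈ p t, ?_⟩
    rw [prod_X_eq_monomial]
    refine congrArg (fun s => monomial s (1 : k)) (Finsupp.ext fun t => ?_)
    rw [faceExp_apply, Finsupp.finsetSum_apply]
    simp [Finsupp.single_apply]
  · have hj : monomial (faceExp p j) (1 : k) ∈ faceIdeal p k := Ideal.subset_span ⟨j, rfl⟩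
    rw [← h, ← Set.image_image (fun s => monomial s (1 : k)) (faceExp p),
      monomial_mem_span_image_iff] at hj
    obtain ⟨_, ⟨i, hij, rfl⟩, hle⟩ := hj
    obtain ⟨F, hF, hiF, hjF⟩ := hsep i j hij
    have := hle ⟨F, hF, fun h => by simp [Set.mem_singleton_iff.1 h] at hiF⟩
    simp [faceExp_apply, p, hiF, hjF] at this
  · have hyper (F) : F ∈ hypergraphOf (fun j => monomial (faceExp p j) (1 : k)) ↔
        ∃ t, p t = F := by
      refine exists_congr fun t => ?_
      simp only [X_dvd_monomial_one_iff, faceExp_ne_zero_iff, Finset.ext_iff]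
    ext F
    rw [Set.mem_sdiff, hyper]
    constructor
    · rintro ⟨⟨t, rfl⟩, -⟩
      exact t.down.2
    · intro hF
      exact ⟨⟨⟨F, hF⟩, rfl⟩, hF.2⟩

theorem proposition2p2 (k : Type w) [Field k] {μ : ℕ}
    (H : Set (Finset (Fin μ))) (hH : IsSeparatedHypergraph H) :
    -- any two ideals associated to `H` have the same total Betti numbers
    -- and the same projective dimension
    (∀ (σ₁ : Type u₁) (σ₂ : Type u₂)
        (I₁ : Ideal (MvPolynomial σ₁ k)) (I₂ : Ideal (MvPolynomial σ₂ k)),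
        IsAssociatedTo I₁ H → IsAssociatedTo I₂ H →
          (∀ l : ℕ, totalBetti l (idealModule I₁) = totalBetti l (idealModule I₂)) ∧
          (∀ l : ℕ, totalBetti l (quotientModule I₁) = totalBetti l (quotientModule I₂)) ∧
          projectiveDimension (quotientModule I₁) = projectiveDimension (quotientModule I₂)) ∧
    -- hence `pd(H)` is well defined: there is exactly one value that is the projective
    -- dimension of `R / I` for every ideal `I` associated to `H`
    (∃! d : WithBot ℕ∞, ∀ (σ : Type u₁) (I : Ideal (MvPolynomial σ k)),
        IsAssociatedTo I H → projectiveDimension (quotientModule I) = d) := by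
  refine ⟨?_, ?_⟩
  · intro σ₁ σ₂ I₁ I₂ h₁ h₂
    obtain ⟨q₁, hfin₁, hq₁, rfl⟩ := exists_eq_map_faceIdeal h₁
    obtain ⟨q₂, hfin₂, hq₂, rfl⟩ := exists_eq_map_faceIdeal h₂
    obtain ⟨a₁, b₁, c₁⟩ := invariants_map_fiberHom q₁ hfin₁ hq₁ (faceIdeal Subtype.val k)
    obtain ⟨a₂, b₂, c₂⟩ := invariants_map_fiberHom q₂ hfin₂ hq₂ (faceIdeal Subtype.val k)
    exact ⟨fun l => (a₁ l).trans (a₂ l).symm, fun l => (b₁ l).trans (b₂ l).symm, c₁.trans c₂.symm⟩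
  · refine ⟨projectiveDimension (quotientModule (faceIdeal (Subtype.val (p := (· ∈ H \ {∅}))) k)),
      fun σ I hI => ?_, fun d hd => ?_⟩
    · obtain ⟨q, hfin, hq, rfl⟩ := exists_eq_map_faceIdeal hI
      exact (invariants_map_fiberHom q hfin hq _).2.2
    · have hI := isAssociatedTo_faceIdeal.{u₁} k hH
      rw [← hd _ _ hI]
      obtain ⟨q, hfin, hq, h⟩ := exists_eq_map_faceIdeal hI
      rw [h]
      exact (invariants_map_fiberHom q hfin hq _).2.2
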